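/- Let $X_{free}\subset\mathbb R^d$ be a Borel set with $0<\mathrm{vol}(X_{free})<\infty$, let $\alpha>0$ and $\gamma\in(0,1)$, and put $\mathbb P(B_\alpha)=\mathrm{vol}(B_\alpha)/\mathrm{vol}(X_{free})$, where $\mathrm{vol}$ is Lebesgue measure and $B_\alpha$ is a Euclidean ball of radius $\alpha$ in $\mathbb R^d$. For $\delta>0$, a continuous path $\sigma:[0,1]\to\mathbb R^d$ is called $\delta$-clear if the (open) ball of radius $\delta$ centred at $\sigma(t)$ is contained in $X_{free}$ for every $t\in[0,1]$, and feasible if $\sigma(t)\in X_{free}$ for every $t\in[0,1]$. For a finite set $N\subset\mathbb R^d$ of samples, the radius PRM (probabilistic roadmap) with connection radius $r$ is the following procedure. It builds the undirected graph with vertex set $N$ in which two distinct samples are joined by an edge when their distance is at most $r$ and the straight segment between them lies in $X_{free}$. Given a start $x_s$ and a goal $x_g$, it adds these two points to the graph and joins each of them to every sample at distance at most $r$ for which the connecting segment lies in $X_{free}$. It then returns the polygonal path along a path of least Euclidean length from $x_s$ to $x_g$ in this graph, and it reports failure if $x_s$ and $x_g$ are not connected in it. Let $N$ consist of $n$ independent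 samples, each uniformly distributed on $X_{free}$, where $$n\ \ge\ \max\left\{\frac{4}{\mathbb P(B_\alpha)}\log_2\frac{2}{\gamma},\ \frac{8d}{\mathbb P(B_\alpha)}\log_2\frac{13}{\mathbb P(B_\alpha)}\right\}.$$ Then, with probability at least $1-\gamma$, the following holds simultaneously for all $x_s,x_g\in X_{free}$: if there is a $2\alpha$-clear path from $x_s$ to $x_g$, then the radius PRM on $N$ with connection radius $4\alpha$ returns a feasible path from $x_s$ to $x_g$. -/

import Mathlib

namespace RadiusPRM

variable {d : ℕ}

/-- A path `σ : [0,1] → ℝ^d` is `δ`-clear if every ball of radius `δ` centred on it lies in the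
free space. (Clearance is asked of open balls only, the least demanding convention.) -/
def IsClear (Xfree : Set (EuclideanSpace ℝ (Fin d))) (δ : ℝ)
    {x y : EuclideanSpace ℝ (Fin d)} (σ : Path x y) : Prop :=
  ∀ t : unitInterval, Metric.ball (σ t) δ ⊆ Xfree

/-- A path is feasible if it stays in the free space. -/
def IsFeasible (Xfree : Set (EuclideanSpace ℝ (Fin d)))
    {x y : EuclideanSpace ℝ (Fin d)} (σ : Path x y) : Prop :=
  ∀ t : unitInterval, σ t ∈ Xfree

/-- `ℙ(B_α^d)`: the volume of a `d`-dimensional ball of radius `α`, as a fraction of the volume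
of the free space. -/
noncomputable def ballProb (Xfree : Set (EuclideanSpace ℝ (Fin d))) (α : ℝ) : ℝ :=
  MeasureTheory.volume.real (Metric.ball (0 : EuclideanSpace ℝ (Fin d)) α) /
    MeasureTheory.volume.real Xfree

/-- The linear path between the two configurations is collision-free. -/
def CollisionFree (Xfree : Set (EuclideanSpace ℝ (Fin d)))
    (u v : EuclideanSpace ℝ (Fin d)) : Prop :=
  segment ℝ u v ⊆ Xfree

/-- The range search of a radius PRM: the points of `V` within distance `r` of `v`. -/
def near (r : ℝ) (v : EuclideanSpace ℝ (Fin d)) (V : Set (EuclideanSpace ℝ (Fin d))) :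
    Set (EuclideanSpace ℝ (Fin d)) :=
  {u | u ∈ V ∧ dist u v ≤ r}

/-- The roadmap built on the sample set `V`: each sample `v` is joined to every other sample
within the connection radius for which the connecting segment is collision-free.
(Edges are undirected; points outside `V` are isolated.) -/
def roadmap (Xfree : Set (EuclideanSpace ℝ (Fin d))) (r : ℝ)
    (V : Set (EuclideanSpace ℝ (Fin d))) : SimpleGraph (EuclideanSpace ℝ (Fin d)) :=
  SimpleGraph.fromRel fun v u => v ∈ V ∧ u ∈ near r v (V \ {v}) ∧ CollisionFree Xfree v u

/-- The edges by which a query joins the start or goal `x` to the samples near it. -/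
def queryEdges (Xfree : Set (EuclideanSpace ℝ (Fin d))) (r : ℝ)
    (V : Set (EuclideanSpace ℝ (Fin d))) (x : EuclideanSpace ℝ (Fin d)) :
    SimpleGraph (EuclideanSpace ℝ (Fin d)) :=
  SimpleGraph.fromRel fun v u => v = x ∧ u ∈ near r v V ∧ CollisionFree Xfree v u

/-- The roadmap together with the edges added for the query from `xs` to `xg`. -/
def queryGraph (Xfree : Set (EuclideanSpace ℝ (Fin d))) (r : ℝ)
    (V : Set (EuclideanSpace ℝ (Fin d))) (xs xg : EuclideanSpace ℝ (Fin d)) :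
    SimpleGraph (EuclideanSpace ℝ (Fin d)) :=
  roadmap Xfree r V ⊔ queryEdges Xfree r V xs ⊔ queryEdges Xfree r V xg

/-- The Euclidean length of a walk in a graph of configurations. -/
noncomputable def walkLength {G : SimpleGraph (EuclideanSpace ℝ (Fin d))}
    {x y : EuclideanSpace ℝ (Fin d)} (w : G.Walk x y) : ℝ :=
  (w.darts.map fun e => dist e.fst e.snd).sum

/-- `w` has least Euclidean length among all walks with its endpoints. -/
def IsShortest {G : SimpleGraph (EuclideanSpace ℝ (Fin d))}
    {x y : EuclideanSpace ℝ (Fin d)} (w : G.Walk x y) : Prop :=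
  ∀ w' : G.Walk x y, walkLength w ≤ walkLength w'

open Classical in
/-- Shortest-path search: some shortest walk from `x` to `y` if there is one, else failure. -/
noncomputable def shortestPath (G : SimpleGraph (EuclideanSpace ℝ (Fin d)))
    (x y : EuclideanSpace ℝ (Fin d)) : Option (G.Walk x y) :=
  if h : ∃ w : G.Walk x y, IsShortest w then some h.choose else none

/-- The polygonal path in configuration space that follows the edges of a walk. -/
noncomputable def polygonalPath {G : SimpleGraph (EuclideanSpace ℝ (Fin d))} :
    {x y : EuclideanSpace ℝ (Fin d)} → G.Walk x y → Path x y
  | x, _, .nil => Path.refl x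
  | _, _, .cons (u := x) (v := v) _ w => (Path.segment x v).trans (polygonalPath w)

/-- The radius PRM with connection radius `r` and sample set `V`, queried for a path from `xs`
to `xg`: the path it returns, or `none` if it reports failure. -/
noncomputable def radiusPRM (Xfree : Set (EuclideanSpace ℝ (Fin d))) (r : ℝ)
    (V : Set (EuclideanSpace ℝ (Fin d))) (xs xg : EuclideanSpace ℝ (Fin d)) :
    Option (Path xs xg) :=
  (shortestPath (queryGraph Xfree r V xs xg) xs xg).map polygonalPath

end RadiusPRM

/-! Write `ε` for `ballProb Xfree α`. A maximal `α`-separated set `T` of `2α`-clear points is an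
`α`-net of them, and packing half-radius balls gives at most `2 ^ d / ε` points (`exists_net`). A
fixed ball of radius `α` about a net point is missed by all samples with probability `(1 - ε) ^ n`,
so the union bound and the choice of `n` (`union_bound_le`) leave every such ball hit with
probability at least `1 - γ`. The rest is deterministic (`reachable_of_isClear`): each point of a
clear path has a sample within `2α`, and samples chosen for nearby points share a free, convex ball
of radius `2α`. Since `T` depends on neither query nor path, one event serves all queries. -/

namespace RadiusPRM

open MeasureTheory Set

variable {d : ℕ}

/-! ### Shortest walks and their polygonal paths -/

section Graph

variable {G : SimpleGraph (EuclideanSpace ℝ (Fin d))} {x y : EuclideanSpace ℝ (Fin d)}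

open Classical in
theorem walkLength_bypass_le (w : G.Walk x y) : walkLength w.bypass ≤ walkLength w := by
  unfold walkLength
  refine (w.darts_bypass_sublist_darts.map _).sum_le_sum ?_
  intro a ha
  obtain ⟨e, -, rfl⟩ := List.mem_map.1 ha
  exact dist_nonneg

-- A path repeats no dart, so its length is a sum over a subset of the finite set `S ×ˢ S`.
open Classical in
theorem finite_walkLength_isPath {S : Set (EuclideanSpace ℝ (Fin d))} (hS : S.Finite)
    (hG : ∀ u v, G.Adj u v → u ∈ S) (x y : EuclideanSpace ℝ (Fin d)) :
    {l : ℝ | ∃ w : G.Walk x y, w.IsPath ∧ walkLength w = l}.Finite := by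
  have hSS : (S ×ˢ S).Finite := hS.prod hS
  refine (((hSS.toFinset.powerset).image
    fun F => ∑ e ∈ F, dist e.1 e.2).finite_toSet).subset ?_
  rintro l ⟨w, hw, rfl⟩
  simp only [Finset.coe_image, Set.mem_image, Finset.mem_coe, Finset.mem_powerset]
  refine ⟨(w.darts.map SimpleGraph.Dart.toProd).toFinset, ?_, ?_⟩
  · intro e he
    simp only [List.mem_toFinset, List.mem_map] at he
    obtain ⟨a, -, rfl⟩ := he
    simp only [Set.Finite.mem_toFinset, Set.mem_prod]
    exact ⟨hG _ _ a.adj, hG _ _ a.adj.symm⟩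
  · have hnd : (w.darts.map SimpleGraph.Dart.toProd).Nodup :=
      (SimpleGraph.Walk.darts_nodup_of_support_nodup hw.support_nodup).map
        (SimpleGraph.Dart.toProd_injective)
    rw [List.sum_toFinset _ hnd, List.map_map]
    rfl

/-- A graph with finitely many non-isolated vertices has shortest walks between connected points. -/
theorem exists_isShortest {S : Set (EuclideanSpace ℝ (Fin d))} (hS : S.Finite)
    (hG : ∀ u v, G.Adj u v → u ∈ S) (h : G.Reachable x y) :
    ∃ w : G.Walk x y, IsShortest w := by
  classical
  obtain ⟨w₀⟩ := h
  obtain ⟨l, ⟨w, -, rfl⟩, hmin⟩ := Set.exists_min_image _ id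
    (finite_walkLength_isPath hS hG x y) ⟨_, w₀.bypass, w₀.bypass_isPath, rfl⟩
  exact ⟨w, fun w' => (hmin _ ⟨w'.bypass, w'.bypass_isPath, rfl⟩).trans
    (walkLength_bypass_le w')⟩

theorem isFeasible_polygonalPath {Xfree : Set (EuclideanSpace ℝ (Fin d))}
    (hG : ∀ u v, G.Adj u v → CollisionFree Xfree u v) :
    ∀ {x y : EuclideanSpace ℝ (Fin d)} (w : G.Walk x y), x ∈ Xfree →
      IsFeasible Xfree (polygonalPath w)
  | x, _, .nil, hx => fun t => by simpa [polygonalPath] using hx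
  | _, _, .cons (u := x) (v := v) h w, hx => by
    have hseg : segment ℝ x v ⊆ Xfree := hG _ _ h
    have ih := isFeasible_polygonalPath hG w (hseg (right_mem_segment ℝ x v))
    have : range (polygonalPath (.cons h w)) ⊆ Xfree := by
      rw [polygonalPath, Path.trans_range, Path.range_segment]
      exact union_subset hseg (range_subset_iff.2 ih)
    exact range_subset_iff.1 this

end Graph

/-! ### Connectivity of the query graph -/

section Query

variable {Xfree V : Set (EuclideanSpace ℝ (Fin d))} {r : ℝ}
  {xs xg u v : EuclideanSpace ℝ (Fin d)}

theorem CollisionFree.symm (h : CollisionFree Xfree u v) : CollisionFree Xfree v u := by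
  unfold CollisionFree
  rwa [segment_symm]

theorem collisionFree_of_adj_queryGraph (h : (queryGraph Xfree r V xs xg).Adj u v) :
    CollisionFree Xfree u v := by
  simp only [queryGraph, roadmap, queryEdges, SimpleGraph.sup_adj, SimpleGraph.fromRel_adj] at h
  rcases h with (⟨-, h | h⟩ | ⟨-, h | h⟩) | ⟨-, h | h⟩
  all_goals first | exact h.2.2 | exact h.2.2.symm

theorem mem_of_adj_queryGraph (h : (queryGraph Xfree r V xs xg).Adj u v) :
    u ∈ V ∪ {xs, xg} := by
  simp only [queryGraph, roadmap, queryEdges, near, SimpleGraph.sup_adj,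
    SimpleGraph.fromRel_adj, mem_ofPred_eq, mem_sdiff] at h
  simp only [mem_union, mem_insert_iff, mem_singleton_iff]
  tauto

/-- If start and goal are connected in the query graph, the radius PRM returns a feasible path. -/
theorem exists_radiusPRM_eq_some (hV : V.Finite) (hxs : xs ∈ Xfree)
    (h : (queryGraph Xfree r V xs xg).Reachable xs xg) :
    ∃ p : Path xs xg, radiusPRM Xfree r V xs xg = some p ∧ IsFeasible Xfree p := by
  have hw := exists_isShortest (hV.union (toFinite {xs, xg}))
    (fun _ _ => mem_of_adj_queryGraph) h
  refine ⟨polygonalPath hw.choose, ?_,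
    isFeasible_polygonalPath (fun _ _ => collisionFree_of_adj_queryGraph) _ hxs⟩
  simp only [radiusPRM, shortestPath, dif_pos hw, Option.map_some]

theorem reachable_of_mem_samples (hu : u ∈ V) (hv : v ∈ V) (hd : dist u v ≤ r)
    (hc : CollisionFree Xfree u v) : (queryGraph Xfree r V xs xg).Reachable u v := by
  -- The graph has no loops, and different path points may have been given the same sample.
  rcases eq_or_ne u v with rfl | hne
  · rfl
  refine SimpleGraph.Adj.reachable ?_
  rw [queryGraph, SimpleGraph.sup_adj, SimpleGraph.sup_adj, roadmap, SimpleGraph.fromRel_adj]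
  exact .inl (.inl ⟨hne, .inl ⟨hu, ⟨⟨hv, hne.symm⟩, by rwa [dist_comm]⟩, hc⟩⟩)

theorem reachable_start (hv : v ∈ V) (hd : dist v xs ≤ r)
    (hc : CollisionFree Xfree xs v) : (queryGraph Xfree r V xs xg).Reachable xs v := by
  rcases eq_or_ne xs v with rfl | hne
  · rfl
  refine SimpleGraph.Adj.reachable ?_
  rw [queryGraph, SimpleGraph.sup_adj, SimpleGraph.sup_adj, queryEdges, SimpleGraph.fromRel_adj]
  exact .inl (.inr ⟨hne, .inl ⟨rfl, ⟨hv, hd⟩, hc⟩⟩)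

theorem reachable_goal (hv : v ∈ V) (hd : dist v xg ≤ r)
    (hc : CollisionFree Xfree xg v) : (queryGraph Xfree r V xs xg).Reachable xg v := by
  rcases eq_or_ne xg v with rfl | hne
  · rfl
  refine SimpleGraph.Adj.reachable ?_
  rw [queryGraph, SimpleGraph.sup_adj, queryEdges, queryEdges, SimpleGraph.fromRel_adj]
  exact .inr ⟨hne, .inl ⟨rfl, ⟨hv, hd⟩, hc⟩⟩

/-- If the balls of radius `α` around every point of an `α`-net of the `2α`-clear configurations
contain samples, then the endpoints of a `2α`-clear path are connected in the query graph. -/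
theorem reachable_of_isClear {α : ℝ} (hα : 0 < α) {T : Set (EuclideanSpace ℝ (Fin d))}
    (hnet : ∀ c, Metric.ball c (2 * α) ⊆ Xfree → ∃ t ∈ T, dist c t < α)
    (hit : ∀ t ∈ T, ∃ v ∈ V, dist v t < α)
    (σ : Path xs xg) (hσ : IsClear Xfree (2 * α) σ) :
    (queryGraph Xfree (4 * α) V xs xg).Reachable xs xg := by
  choose t htT ht using fun s => hnet (σ s) (hσ s)
  choose p hpV hp using fun s => hit (t s) (htT s)
  have near_p : ∀ s s', dist (σ s') (t s) < α → p s ∈ Metric.ball (σ s') (2 * α) := by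
    intro s s' h
    have := dist_triangle_right (p s) (σ s') (t s)
    have := hp s
    rw [Metric.mem_ball]
    linarith
  have free : ∀ s u v, u ∈ Metric.ball (σ s) (2 * α) → v ∈ Metric.ball (σ s) (2 * α) →
      dist u v ≤ 4 * α ∧ CollisionFree Xfree u v := by
    intro s u v hu hv
    refine ⟨?_, ((convex_ball _ _).segment_subset hu hv).trans (hσ s)⟩
    have := dist_triangle_right u v (σ s)
    rw [Metric.mem_ball] at hu hv
    linarith
  have center : ∀ s, σ s ∈ Metric.ball (σ s) (2 * α) := fun s =>
    Metric.mem_ball_self (by linarith)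
  have : Std.Symm fun s s' => (queryGraph Xfree (4 * α) V xs xg).Reachable (p s) (p s') :=
    ⟨fun _ _ h => h.symm⟩
  have key : (queryGraph Xfree (4 * α) V xs xg).Reachable (p 0) (p 1) := by
    -- The unit interval is connected, so an equivalence relation linking each point to all nearby
    -- ones links `0` to `1`.
    refine PreconnectedSpace.induction₂
      (fun s s' => (queryGraph Xfree (4 * α) V xs xg).Reachable (p s) (p s'))
      (fun s => ?_) ⟨fun _ _ _ h h' => h.trans h'⟩ 0 1
    have hc : Continuous fun s' => dist (σ s') (t s) := by fun_prop
    -- While `σ s'` stays within `α` of `t s`, both `p s` and `p s'` lie in the ball of radius `2α`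
    -- about `σ s'`.
    filter_upwards [hc.continuousAt.eventually (gt_mem_nhds (ht s))] with s' hs'
    obtain ⟨h1, h2⟩ := free s' _ _ (near_p s s' hs') (near_p s' s' (ht s'))
    exact reachable_of_mem_samples (hpV s) (hpV s') h1 h2
  have h0 : (queryGraph Xfree (4 * α) V xs xg).Reachable xs (p 0) := by
    obtain ⟨h1, h2⟩ := free 0 _ _ (center 0) (near_p 0 0 (ht 0))
    rw [σ.source] at h1 h2
    exact reachable_start (hpV 0) (by rwa [dist_comm]) h2
  have h1 : (queryGraph Xfree (4 * α) V xs xg).Reachable xg (p 1) := by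
    obtain ⟨h1, h2⟩ := free 1 _ _ (center 1) (near_p 1 1 (ht 1))
    rw [σ.target] at h1 h2
    exact reachable_goal (hpV 1) (by rwa [dist_comm]) h2
  exact (h0.trans key).trans h1.symm

end Query

/-! ### Packing and nets -/

section Net

variable {Xfree : Set (EuclideanSpace ℝ (Fin d))} {α : ℝ}

theorem volume_real_ball (α : ℝ) (c : EuclideanSpace ℝ (Fin d)) (s : ℝ) (hs : 0 < s) :
    volume.real (Metric.ball c (s * α)) =
      s ^ d * volume.real (Metric.ball (0 : EuclideanSpace ℝ (Fin d)) α) := by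
  rw [measureReal_def, Measure.addHaar_ball_mul_of_pos volume c hs α, ENNReal.toReal_mul,
    ENNReal.toReal_ofReal (by positivity), finrank_euclideanSpace_fin, measureReal_def]

/-- Packing bound for separated sets of clear configurations. -/
theorem card_mul_le_volume (hfin : volume Xfree < ⊤) (hα : 0 < α)
    {T : Finset (EuclideanSpace ℝ (Fin d))}
    (hT : ∀ c ∈ T, Metric.ball c (2 * α) ⊆ Xfree)
    (hsep : (T : Set (EuclideanSpace ℝ (Fin d))).Pairwise fun a b => α ≤ dist a b) :
    (T.card : ℝ) * ((1 / 2) ^ d * volume.real (Metric.ball (0 : EuclideanSpace ℝ (Fin d)) α)) ≤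
      volume.real Xfree := by
  have hdisj : (T : Set (EuclideanSpace ℝ (Fin d))).PairwiseDisjoint
      fun c => Metric.ball c (1 / 2 * α) := by
    intro a ha b hb hab
    exact Metric.ball_disjoint_ball (by have := hsep ha hb hab; linarith)
  have hsub : (⋃ c ∈ T, Metric.ball c (1 / 2 * α)) ⊆ Xfree :=
    iUnion₂_subset fun c hc => (Metric.ball_subset_ball (by linarith)).trans (hT c hc)
  calc (T.card : ℝ) * ((1 / 2) ^ d * volume.real (Metric.ball (0 : EuclideanSpace ℝ (Fin d)) α))
      = ∑ c ∈ T, volume.real (Metric.ball c (1 / 2 * α)) := by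
        simp only [volume_real_ball α _ (1 / 2) (by norm_num), Finset.sum_const, nsmul_eq_mul]
    _ = volume.real (⋃ c ∈ T, Metric.ball c (1 / 2 * α)) :=
        (measureReal_biUnion_finset hdisj (fun _ _ => Metric.isOpen_ball.measurableSet)
          (fun _ _ => Metric.isBounded_ball.measure_lt_top.ne)).symm
    _ ≤ volume.real Xfree := measureReal_mono hsub hfin.ne

theorem ballProb_pos (hpos : 0 < volume Xfree) (hfin : volume Xfree < ⊤) (hα : 0 < α) :
    0 < ballProb Xfree α :=
  div_pos (ENNReal.toReal_pos (Metric.measure_ball_pos volume _ hα).ne'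
    Metric.isBounded_ball.measure_lt_top.ne) (ENNReal.toReal_pos hpos.ne' hfin.ne)

/-- A finite `α`-net of the `2α`-clear configurations with at most `2 ^ d / ℙ(B_α)` points. -/
theorem exists_net (hpos : 0 < volume Xfree) (hfin : volume Xfree < ⊤) (hα : 0 < α) :
    ∃ T : Finset (EuclideanSpace ℝ (Fin d)),
      (∀ c ∈ T, Metric.ball c (2 * α) ⊆ Xfree) ∧
      (∀ c, Metric.ball c (2 * α) ⊆ Xfree → ∃ t ∈ T, dist c t < α) ∧
      (T.card : ℝ) ≤ 2 ^ d / ballProb Xfree α := by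
  classical
  have hε := ballProb_pos hpos hfin hα
  let 𝒯 : Set (Finset (EuclideanSpace ℝ (Fin d))) :=
    {T | (∀ c ∈ T, Metric.ball c (2 * α) ⊆ Xfree) ∧
      (T : Set (EuclideanSpace ℝ (Fin d))).Pairwise fun a b => α ≤ dist a b}
  have hcard : ∀ T ∈ 𝒯, (T.card : ℝ) ≤ 2 ^ d / ballProb Xfree α := by
    rintro T ⟨h1, h2⟩
    have h := card_mul_le_volume hfin hα h1 h2
    have hv : 0 < volume.real Xfree := ENNReal.toReal_pos hpos.ne' hfin.ne
    rw [le_div_iff₀ hε, ballProb, ← mul_div_assoc, div_le_iff₀ hv]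
    calc _ = 2 ^ d * ((T.card : ℝ) * ((1 / 2) ^ d *
          volume.real (Metric.ball (0 : EuclideanSpace ℝ (Fin d)) α))) := by
          rw [one_div, inv_pow]; field_simp
      _ ≤ _ := by gcongr
  have hbdd : BddAbove (Finset.card '' 𝒯) := by
    refine ⟨⌊2 ^ d / ballProb Xfree α⌋₊, ?_⟩
    rintro _ ⟨T, hT, rfl⟩
    exact Nat.le_floor (hcard T hT)
  have hne : (Finset.card '' 𝒯).Nonempty := ⟨_, ∅, by simp [𝒯], rfl⟩
  obtain ⟨T, hT, hTmax⟩ := Nat.sSup_mem hne hbdd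
  refine ⟨T, hT.1, fun c hc => ?_, hcard T hT⟩
  -- A clear point at distance at least `α` from all of `T` could be added to it, against maximal
  -- cardinality.
  by_contra! hfar
  have hcT : c ∉ T := fun h => by
    have := hfar c h
    rw [dist_self] at this
    linarith
  have hmem : insert c T ∈ 𝒯 := by
    refine ⟨fun a ha => ?_, ?_⟩
    · rcases Finset.mem_insert.1 ha with rfl | ha
      exacts [hc, hT.1 a ha]
    · rw [Finset.coe_insert]
      exact hT.2.insert fun b hb _ => ⟨hfar b hb, by rw [dist_comm]; exact hfar b hb⟩
  have hle := le_csSup hbdd (mem_image_of_mem Finset.card hmem)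
  rw [← hTmax, Finset.card_insert_of_notMem hcT] at hle
  omega

end Net

/-! ### Probability of hitting the whole net -/

section Probability

variable {Ω : Type*} [MeasurableSpace Ω] {P : Measure Ω} [IsProbabilityMeasure P]
  {Xfree : Set (EuclideanSpace ℝ (Fin d))} {α : ℝ} {n : ℕ}
  {N : Fin n → Ω → EuclideanSpace ℝ (Fin d)}

/-- The probability that no sample falls into a ball of radius `α` inside the free space. -/
theorem measureReal_iInter_preimage_compl_ball
    (hpos : 0 < volume Xfree) (hfin : volume Xfree < ⊤)
    (hN : ∀ i, Measurable (N i))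
    (hunif : ∀ i, pdf.IsUniform (N i) Xfree P volume)
    (hindep : ProbabilityTheory.iIndepFun N P)
    {c : EuclideanSpace ℝ (Fin d)} (hc : Metric.ball c α ⊆ Xfree) :
    P.real (⋂ i, N i ⁻¹' (Metric.ball c α)ᶜ) = (1 - ballProb Xfree α) ^ n := by
  have hb : MeasurableSet (Metric.ball c α) := Metric.isOpen_ball.measurableSet
  have h1 : ∀ i, P.real (N i ⁻¹' (Metric.ball c α)ᶜ) = 1 - ballProb Xfree α := by
    intro i
    have hvol := volume_real_ball α c 1 one_pos
    rw [one_mul, one_pow, one_mul] at hvol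
    rw [preimage_compl, probReal_compl_eq_one_sub (hN i hb), measureReal_def,
      (hunif i).measure_preimage hpos.ne' hfin.ne hb, inter_eq_self_of_subset_right hc,
      ENNReal.toReal_div, ballProb, ← hvol, measureReal_def, measureReal_def]
  rw [measureReal_def, hindep.meas_iInter fun i => ⟨_, hb.compl, rfl⟩, ENNReal.toReal_prod]
  simp only [← measureReal_def, h1, Finset.prod_const, Finset.card_univ, Fintype.card_fin]

theorem log_le_logb_two {x : ℝ} (hx : 1 ≤ x) : Real.log x ≤ Real.logb 2 x := by
  rw [Real.logb, le_div_iff₀ (Real.log_pos one_lt_two)]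
  have h2 : Real.log 2 ≤ 1 := (Real.log_two_lt_d9.trans (by norm_num)).le
  exact mul_le_of_le_one_right (Real.log_nonneg hx) h2

/-- Each term of the maximum pays for half of `ε * n ≥ log (1 / γ) + d * log (2 / ε)`, with room to
spare. Then `(1 - ε) ^ n ≤ exp (-ε * n) ≤ γ * (ε / 2) ^ d`, and `ε ^ d ≤ ε` absorbs the remaining `1
/ ε`; this is where `d ≠ 0` enters. -/
theorem union_bound_le {d n : ℕ} (hd : d ≠ 0) {ε γ : ℝ} (hε0 : 0 < ε) (hε1 : ε ≤ 1)
    (hγ0 : 0 < γ) (hγ1 : γ < 1)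
    (hn : max ((4 / ε) * Real.logb 2 (2 / γ)) ((8 * (d : ℝ) / ε) * Real.logb 2 (13 / ε)) ≤
      (n : ℝ)) :
    2 ^ d / ε * (1 - ε) ^ n ≤ γ := by
  obtain ⟨hn1, hn2⟩ := max_le_iff.1 hn
  have hγi : 1 < γ⁻¹ := (one_lt_inv₀ hγ0).2 hγ1
  have hεi : 1 ≤ ε⁻¹ := (one_le_inv₀ hε0).2 hε1
  have e1 : 2 * Real.log γ⁻¹ ≤ ε * n := by
    have l1 : Real.log γ⁻¹ ≤ Real.log (2 / γ) :=
      Real.log_le_log (by positivity) (by rw [div_eq_mul_inv]; linarith)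
    have l2 := log_le_logb_two (x := 2 / γ) (by rw [div_eq_mul_inv]; linarith)
    have l3 : 0 < Real.log γ⁻¹ := Real.log_pos hγi
    rw [div_mul_eq_mul_div, div_le_iff₀ hε0] at hn1
    linarith
  have e2 : 2 * (d * Real.log (2 / ε)) ≤ ε * n := by
    have l1 : Real.log (2 / ε) ≤ Real.log (13 / ε) :=
      Real.log_le_log (by positivity) (by gcongr; norm_num)
    have l2 := log_le_logb_two (x := 13 / ε) (by rw [div_eq_mul_inv]; linarith)
    have l3 : 0 ≤ Real.log (2 / ε) := Real.log_nonneg (by rw [div_eq_mul_inv]; linarith)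
    rw [div_mul_eq_mul_div, div_le_iff₀ hε0] at hn2
    have l4 : (d : ℝ) * Real.log (2 / ε) ≤ d * Real.logb 2 (13 / ε) := by
      gcongr; linarith
    have l5 : 0 ≤ (d : ℝ) * Real.log (2 / ε) := by positivity
    linarith
  have hexp : (1 - ε) ^ n ≤ γ * (ε / 2) ^ d := by
    calc (1 - ε) ^ n ≤ Real.exp (-ε) ^ n := by
          exact pow_le_pow_left₀ (by linarith) (Real.one_sub_le_exp_neg ε) n
      _ = Real.exp (-(ε * n)) := by rw [← Real.exp_nat_mul]; ring_nf
      _ ≤ Real.exp (Real.log γ + d * Real.log (ε / 2)) := by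
          rw [Real.log_inv] at e1
          rw [← inv_div ε 2, Real.log_inv] at e2
          refine Real.exp_le_exp.2 ?_
          linarith
      _ = γ * (ε / 2) ^ d := by
          rw [Real.exp_add, Real.exp_log hγ0, Real.exp_nat_mul, Real.exp_log (by positivity)]
  calc 2 ^ d / ε * (1 - ε) ^ n ≤ 2 ^ d / ε * (γ * (ε / 2) ^ d) := by gcongr
    _ = γ * (ε ^ d / ε) := by rw [div_pow]; field_simp
    _ ≤ γ * 1 := by
        gcongr
        exact (div_le_one hε0).2 (pow_le_of_le_one hε0.le hε1 hd)
    _ = γ := mul_one γ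

/-- With probability at least `1 - γ`, every ball of radius `α` around a point of a small net of
clear configurations contains a sample. -/
theorem ofReal_one_sub_le_measure_hit (hd : d ≠ 0)
    (hpos : 0 < volume Xfree) (hfin : volume Xfree < ⊤) (hα : 0 < α) {γ : ℝ}
    (hγ0 : 0 < γ) (hγ1 : γ < 1)
    (hN : ∀ i, Measurable (N i))
    (hunif : ∀ i, pdf.IsUniform (N i) Xfree P volume)
    (hindep : ProbabilityTheory.iIndepFun N P)
    (hn : max ((4 / ballProb Xfree α) * Real.logb 2 (2 / γ))
        ((8 * (d : ℝ) / ballProb Xfree α) * Real.logb 2 (13 / ballProb Xfree α)) ≤ (n : ℝ))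
    {T : Finset (EuclideanSpace ℝ (Fin d))}
    (hT : ∀ c ∈ T, Metric.ball c (2 * α) ⊆ Xfree)
    (hcard : (T.card : ℝ) ≤ 2 ^ d / ballProb Xfree α) :
    ENNReal.ofReal (1 - γ) ≤ P (⋂ c ∈ T, ⋃ i, N i ⁻¹' Metric.ball c α) := by
  have hball : ∀ c ∈ T, Metric.ball c α ⊆ Xfree := fun c hc =>
    (Metric.ball_subset_ball (by linarith)).trans (hT c hc)
  have hA : MeasurableSet (⋂ c ∈ T, ⋃ i, N i ⁻¹' Metric.ball c α) :=
    T.measurableSet_biInter fun c _ => .iUnion fun i => hN i Metric.isOpen_ball.measurableSet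
  have hcompl : P.real (⋂ c ∈ T, ⋃ i, N i ⁻¹' Metric.ball c α)ᶜ ≤ γ := by
    -- Only a net point, whose ball lies in `Xfree`, guarantees `ε ≤ 1`; with no net point the event
    -- is certain.
    rcases T.eq_empty_or_nonempty with rfl | ⟨c₀, hc₀⟩
    · simpa using hγ0.le
    have hε := ballProb_pos hpos hfin hα
    have hε1 : ballProb Xfree α ≤ 1 := by
      have hvol := volume_real_ball α c₀ 1 one_pos
      rw [one_mul, one_pow, one_mul] at hvol
      rw [ballProb, ← hvol]
      exact div_le_one_of_le₀ (measureReal_mono (hball c₀ hc₀) hfin.ne) measureReal_nonneg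
    calc P.real (⋂ c ∈ T, ⋃ i, N i ⁻¹' Metric.ball c α)ᶜ
        = P.real (⋃ c ∈ T, ⋂ i, N i ⁻¹' (Metric.ball c α)ᶜ) := by
          simp only [compl_iInter, compl_iUnion, preimage_compl]
      _ ≤ ∑ c ∈ T, P.real (⋂ i, N i ⁻¹' (Metric.ball c α)ᶜ) := measureReal_biUnion_finset_le _ _
      _ = T.card * (1 - ballProb Xfree α) ^ n := by
          rw [Finset.sum_congr rfl fun c hc =>
            measureReal_iInter_preimage_compl_ball hpos hfin hN hunif hindep (hball c hc),
            Finset.sum_const, nsmul_eq_mul]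
      _ ≤ 2 ^ d / ballProb Xfree α * (1 - ballProb Xfree α) ^ n := by
          have : 0 ≤ 1 - ballProb Xfree α := by linarith
          gcongr
      _ ≤ γ := union_bound_le hd hε hε1 hγ0 hγ1 hn
  rw [probReal_compl_eq_one_sub hA] at hcompl
  rw [ENNReal.ofReal_le_iff_le_toReal (measure_ne_top _ _), ← measureReal_def]
  linarith

end Probability

end RadiusPRM

theorem theorem1 (d : ℕ) (Xfree : Set (EuclideanSpace ℝ (Fin d)))
    (hmeas : MeasurableSet Xfree)
    (hpos : 0 < MeasureTheory.volume Xfree) (hfin : MeasureTheory.volume Xfree < ⊤)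
    (α : ℝ) (hα : 0 < α) (γ : ℝ) (hγ0 : 0 < γ) (hγ1 : γ < 1)
    {Ω : Type*} [MeasurableSpace Ω] (P : MeasureTheory.Measure Ω)
    [MeasureTheory.IsProbabilityMeasure P]
    (n : ℕ) (N : Fin n → Ω → EuclideanSpace ℝ (Fin d))
    (hN : ∀ i, Measurable (N i))
    (hunif : ∀ i, MeasureTheory.pdf.IsUniform (N i) Xfree P MeasureTheory.volume)
    (hindep : ProbabilityTheory.iIndepFun N P)
    (hn : max ((4 / RadiusPRM.ballProb Xfree α) * Real.logb 2 (2 / γ))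
        ((8 * (d : ℝ) / RadiusPRM.ballProb Xfree α) *
          Real.logb 2 (13 / RadiusPRM.ballProb Xfree α)) ≤ (n : ℝ)) :
    ∃ A : Set Ω, MeasurableSet A ∧ ENNReal.ofReal (1 - γ) ≤ P A ∧
      ∀ ω ∈ A, ∀ xs ∈ Xfree, ∀ xg ∈ Xfree,
        (∃ σ : Path xs xg, RadiusPRM.IsClear Xfree (2 * α) σ) →
        ∃ p : Path xs xg,
          RadiusPRM.radiusPRM Xfree (4 * α) (Set.range fun i => N i ω) xs xg = some p ∧
          RadiusPRM.IsFeasible Xfree p := by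
  -- In dimension zero start and goal coincide, and the trivial walk answers the query.
  rcases eq_or_ne d 0 with rfl | hd
  · refine ⟨Set.univ, MeasurableSet.univ, ?_, fun ω _ xs hxs xg _ _ => ?_⟩
    · rw [MeasureTheory.measure_univ]
      exact ENNReal.ofReal_le_one.2 (by linarith)
    · obtain rfl := Subsingleton.elim xs xg
      exact RadiusPRM.exists_radiusPRM_eq_some (Set.finite_range _) hxs (by rfl)
  obtain ⟨T, hT, hnet, hcard⟩ := RadiusPRM.exists_net hpos hfin hα
  refine ⟨⋂ c ∈ T, ⋃ i, N i ⁻¹' Metric.ball c α,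
    T.measurableSet_biInter fun c _ => .iUnion fun i => hN i Metric.isOpen_ball.measurableSet,
    RadiusPRM.ofReal_one_sub_le_measure_hit hd hpos hfin hα hγ0 hγ1 hN hunif hindep hn hT hcard,
    fun ω hω xs hxs xg _ ⟨σ, hσ⟩ => ?_⟩
  refine RadiusPRM.exists_radiusPRM_eq_some (Set.finite_range _) hxs
    (RadiusPRM.reachable_of_isClear hα (T := T) hnet (fun t ht => ?_) σ hσ)
  obtain ⟨i, hi⟩ := Set.mem_iUnion.1 (Set.mem_iInter₂.1 hω t ht)
  exact ⟨N i ω, Set.mem_range_self i, hi⟩
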